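/- Let $G$ be a connected undirected simple graph on the nodes $\{1,\dots,n\}$, with neighbour sets $N(i)$ and degrees $d(i)$. Let $f_1,\dots,f_n:\mathbb{R}\to\mathbb{R}$ be convex functions all of whose subgradients, at all points, are bounded in absolute value by a constant $L>0$, and suppose that $f(\theta)=\frac1n\sum_{i=1}^n f_i(\theta)$ has a global minimizer $w^*$. Let $U\ge n$ be a real number, let $T\ge 1$ be an integer, and let $\beta=\frac{1}{L\sqrt{UT}}$. Starting from arbitrary real $x_i(1)$ and $y_i(1)=z_i(1)=x_i(1)$, let, for $t\ge 1$ and every node $i$, $$y_i(t+1)=x_i(t)+\frac12\sum_{j\in N(i)}\frac{x_j(t)-x_i(t)}{\max(d(i),d(j))}-\beta g_i(t),$$ $$z_i(t+1)=y_i(t)-\beta g_i(t),$$ $$x_i(t+1)=y_i(t+1)+\Bigl(1-\frac{2}{9U+1}\Bigr)\bigl(y_i(t+1)-z_i(t+1)\bigr),$$ where $g_i(t)$ is any subgradient of $f_i$ at the point $y_i(t)$. Write $\overline{x}=\frac1n\sum_{i=1}^n x_i(1)$ and $\widehat{y}_i(T)=\frac1T\sum_{k=1}^T y_i(k)$, and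 $$\mathrm{Disp}(\theta_1,\dots,\theta_n)=\frac1n\sum_{i=1}^n\bigl|\theta_i-\mathrm{median}(\theta_1,\dots,\theta_n)\bigr|,\qquad \mathrm{Err}(\theta_1,\dots,\theta_n)=\frac1n\sum_{i=1}^n f_i(\theta_i)-f(w^*).$$ **Theorem.** For every constant $C$ there is a constant $K>0$, depending only on $C$, such that for all such $n$, $G$, $f_1,\dots,f_n$, $L$, $w^*$, $U$, $T$, all initial values and all choices of subgradients as above, if $n\le U\le Cn$ (that is, $U\ge n$ and $U=\Theta(n)$), then $$\mathrm{Disp}(\widehat{y}_1(T),\dots,\widehat{y}_n(T))\le K\sqrt{\frac nT}\left(\frac{\|\mathbf{y}(1)-\overline{x}\mathbf{1}\|_2}{\sqrt T}+1\right),$$ $$\bigl|\mathrm{Err}(\widehat{y}_1(T),\dots,\widehat{y}_n(T))\bigr|\le K L\sqrt{\frac nT}\left(\frac{\|\mathbf{y}(1)-\overline{x}\mathbf{1}\|_2}{\sqrt T}+1+(\overline{x}-w^*)^2\right).$$ -/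

import Mathlib

open Finset BigOperators

noncomputable section

namespace DistOpt

/-- `g` is a subgradient of `f : ℝ → ℝ` at the point `θ`. -/
def IsSubgradient (f : ℝ → ℝ) (θ g : ℝ) : Prop :=
  ∀ w : ℝ, f θ + g * (w - θ) ≤ f w

/-- The arithmetic mean of the entries of `v`. -/
def mean {n : ℕ} (v : Fin n → ℝ) : ℝ :=
  (1 / (n : ℝ)) * ∑ i, v i

/-- The objective `f(θ) = (1/n) ∑ᵢ fᵢ(θ)`. -/
def objective {n : ℕ} (f : Fin n → ℝ → ℝ) (θ : ℝ) : ℝ :=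
  (1 / (n : ℝ)) * ∑ i, f i θ

/-- The median of `θ₁, …, θₙ`: with `s` the entries in nondecreasing order, it is the middle entry
of `s` when `n` is odd (the two indices below agree) and the midpoint of the two middle entries
when `n` is even. -/
def median {n : ℕ} (θ : Fin n → ℝ) : ℝ :=
  if h : 0 < n then
    ((θ ∘ Tuple.sort θ) ⟨(n - 1) / 2, by omega⟩ + (θ ∘ Tuple.sort θ) ⟨n / 2, by omega⟩) / 2
  else 0

/-- `Disp(θ₁, …, θₙ) = (1/n) ∑ᵢ |θᵢ - median(θ₁, …, θₙ)|`. -/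
def disp {n : ℕ} (θ : Fin n → ℝ) : ℝ :=
  (1 / (n : ℝ)) * ∑ i, |θ i - median θ|

/-- `Err(θ₁, …, θₙ) = (1/n) ∑ᵢ fᵢ(θᵢ) - f(w)`, to be used with a minimizer `w` of `f`. -/
def err {n : ℕ} (f : Fin n → ℝ → ℝ) (w : ℝ) (θ : Fin n → ℝ) : ℝ :=
  (1 / (n : ℝ)) * ∑ i, f i (θ i) - objective f w

/-- The running averages `ŷᵢ(T) = (1/T) ∑_{k=1}^T yᵢ(k)`. -/
def runningAvg {n : ℕ} (y : ℕ → Fin n → ℝ) (T : ℕ) (i : Fin n) : ℝ :=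
  (1 / (T : ℝ)) * ∑ k ∈ Finset.Icc 1 T, y k i

/-- The Euclidean norm `‖v - c 𝟏‖₂`. -/
def l2Dev {n : ℕ} (v : Fin n → ℝ) (c : ℝ) : ℝ :=
  ‖(WithLp.toLp 2 (fun i => v i - c) : EuclideanSpace ℝ (Fin n))‖

/-- `x, y, z` are generated by the accelerated distributed subgradient protocol on the graph `G`
with parameter `U` and step size `β`, for the local functions `fᵢ`, where `g t i` is the
subgradient used by node `i` at time `t`. Times start at `1`. -/
structure IsProtocolRun {n : ℕ} (G : SimpleGraph (Fin n)) [DecidableRel G.Adj]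
    (f : Fin n → ℝ → ℝ) (U β : ℝ) (x y z g : ℕ → Fin n → ℝ) : Prop where
  init_y : ∀ i, y 1 i = x 1 i
  init_z : ∀ i, z 1 i = x 1 i
  subgradient : ∀ t, 1 ≤ t → ∀ i, IsSubgradient (f i) (y t i) (g t i)
  update_y : ∀ t, 1 ≤ t → ∀ i,
    y (t + 1) i =
      x t i + (1 / 2) * ∑ j ∈ G.neighborFinset i,
          (x t j - x t i) / (max (G.degree i) (G.degree j) : ℝ)
        - β * g t i
  update_z : ∀ t, 1 ≤ t → ∀ i, z (t + 1) i = y t i - β * g t i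
  update_x : ∀ t, 1 ≤ t → ∀ i,
    x (t + 1) i = y (t + 1) i + (1 - 2 / (9 * U + 1)) * (y (t + 1) i - z (t + 1) i)

end DistOpt

end

namespace DistOpt

/-! ### Momentum iterations with a symmetric operator -/

/-! The averages of `x`, `y`, `z` over the nodes coincide at every time, and this common average
performs a plain subgradient step, except that node `i` evaluates its subgradient at `y t i` instead
of at the average. The usual telescoping of the squared distance to `w` (`sum_mean_sub_le`)
therefore bounds the error, at an extra cost of `L` times the mean deviation of the nodes from their
average.

That deviation is the crux. It follows a momentum recursion driven by `deviationMap`, a symmetric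
operator with spectrum in `[0, 1 - 1/(12 n²)]`. The gap comes from a Poincaré inequality along
geodesics, where Metropolis weights cost only `O(n)` because degrees along a geodesic sum to at most
`3n`. Momentum turns a gap of order `1/n²` into a contraction rate `1 - c/U`
(`norm_momentumMap_pow_le`), so the deviations summed over time are `O(U)` times the initial
deviation plus the accumulated noise (`sum_deviation_le`).

With `β = 1/(L√(UT))` and `n ≤ U ≤ Cn`, every term has order `√(n/T)`. Convexity carries the bounds
to the running averages, and the lower bound on the error compares with the value at the mean, which
is at least `f(w)`. -/

lemma sq_le_of_momentum_recurrence {ρ s l : ℝ} (hρ0 : 0 < ρ) (hρ1 : ρ < 1)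
    (hs : s * (1 + ρ) = 1 - ρ) (h0 : 0 ≤ l) (h1 : l ≤ 1 - 2 * ρ ^ 2) {a c : ℕ → ℝ}
    (hac : c 0 = a 0) (ha : ∀ k, a (k + 1) = l * ((1 + s) * a k - s * c k))
    (hc : ∀ k, c (k + 1) = a k) (k : ℕ) : a k ^ 2 ≤ 2 * s ^ k * a 0 ^ 2 := by
  have hs0 : 0 < s := by
    by_contra h
    nlinarith
  have hl1 : 0 < 1 - l := by nlinarith [sq_pos_of_pos hρ0]
  -- One step of the recurrence multiplies this quadratic form by `s * l`, the determinant of its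
  -- companion matrix. Since `c 0 = a 0`, its initial value carries the factor `1 - l`.
  have energy : a k ^ 2 - (1 + s) * l * a k * c k + s * l * c k ^ 2
      = (s * l) ^ k * ((1 - l) * a 0 ^ 2) := by
    induction k with
    | zero => rw [hac]; ring
    | succ k ih =>
      rw [hc, ha]
      linear_combination s * l * ih
  -- This is stronger than having complex roots, `(1 + s)² l ≤ 4 s`. The factor 2 in `l ≤ 1 - 2ρ²`
  -- supplies the margin.
  have hdisc : (1 + s) ^ 2 * l ≤ 2 * s * (1 + l) := by
    have e1 : (1 + s) * (1 + ρ) = 2 := by linarith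
    have e2 : 4 * s = (1 + s) ^ 2 * (1 - ρ ^ 2) := by
      calc 4 * s = ((1 + s) * (1 + ρ)) ^ 2 * s := by rw [e1]; norm_num
        _ = (1 + s) ^ 2 * (1 + ρ) * (s * (1 + ρ)) := by ring
        _ = _ := by rw [hs]; ring
    have e3 : 2 * l ≤ (1 - ρ ^ 2) * (1 + l) := by
      nlinarith [mul_le_mul_of_nonneg_right h1 (by positivity : 0 ≤ 1 + ρ ^ 2),
        sq_nonneg (ρ ^ 2)]
    have := mul_le_mul_of_nonneg_left e3 (sq_nonneg (1 + s))
    nlinarith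
  -- The form dominates `(1 - l)/2 * a²`, by completing the square in `a`. Hence `1 - l` cancels
  -- against the initial energy and the final constant does not degenerate as `l` approaches 1.
  have key : (1 - l) * a k ^ 2 ≤ 2 * ((s * l) ^ k * ((1 - l) * a 0 ^ 2)) := by
    rw [← energy]
    have h := mul_nonneg (sq_nonneg (c k)) (mul_nonneg h0 (sub_nonneg.2 hdisc))
    have h2 : 0 ≤ (1 + l) * (2 * (a k ^ 2 - (1 + s) * l * a k * c k + s * l * c k ^ 2)
        - (1 - l) * a k ^ 2) := by
      have := sq_nonneg ((1 + l) * a k - (1 + s) * l * c k)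
      linear_combination this + h
    have := nonneg_of_mul_nonneg_right h2 (by linarith : 0 < 1 + l)
    linarith
  have hle : (s * l) ^ k ≤ s ^ k :=
    pow_le_pow_left₀ (by positivity) (mul_le_of_le_one_right hs0.le (by linarith)) k
  have key2 : a k ^ 2 ≤ 2 * (s * l) ^ k * a 0 ^ 2 := by
    refine le_of_mul_le_mul_left ?_ hl1
    linarith
  nlinarith [mul_le_mul_of_nonneg_right hle (sq_nonneg (a 0))]

section Momentum

variable {E : Type*} [NormedAddCommGroup E] [InnerProductSpace ℝ E]

/-- The map `(y, z) ↦ (A ((1 + s) y - s z), y)`. -/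
noncomputable def momentumMap (A : E →ₗ[ℝ] E) (s : ℝ) : E × E →ₗ[ℝ] E × E :=
  (A ∘ₗ ((1 + s) • LinearMap.fst ℝ E E - s • LinearMap.snd ℝ E E)).prod (LinearMap.fst ℝ E E)

lemma momentumMap_apply (A : E →ₗ[ℝ] E) (s : ℝ) (p : E × E) :
    momentumMap A s p = (A ((1 + s) • p.1 - s • p.2), p.1) := rfl

/-- In an eigenbasis of `A` the map decouples into scalar recurrences, one per eigenvalue, all
contracting at the common rate `√s`. Starting on the diagonal `(v, v)` matches the condition `c 0 =
a 0` of the scalar lemma. -/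
lemma norm_momentumMap_pow_le [FiniteDimensional ℝ E] {A : E →ₗ[ℝ] E} (hA : A.IsSymmetric)
    {ρ s : ℝ} (hρ0 : 0 < ρ) (hρ1 : ρ < 1) (hs : s * (1 + ρ) = 1 - ρ)
    (h0 : ∀ v, 0 ≤ inner ℝ v (A v)) (h1 : ∀ v, inner ℝ v (A v) ≤ (1 - 2 * ρ ^ 2) * ‖v‖ ^ 2)
    (k : ℕ) (v : E) :
    ‖((momentumMap A s ^ k) (v, v)).1‖ ≤ 2 * (√s ^ k * ‖v‖) := by
  have hs0 : 0 ≤ s := by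
    by_contra h
    nlinarith
  let b := hA.eigenvectorBasis rfl
  have hb : ∀ i, A (b i) = hA.eigenvalues rfl i • b i := fun i =>
    hA.apply_eigenvectorBasis rfl i
  have hq : ∀ i, inner ℝ (b i) (A (b i)) = hA.eigenvalues rfl i := fun i => by
    rw [hb, inner_smul_right, real_inner_self_eq_norm_sq, b.norm_eq_one]
    ring
  have hcoord : ∀ i, inner ℝ (b i) ((momentumMap A s ^ k) (v, v)).1 ^ 2
      ≤ 2 * s ^ k * inner ℝ (b i) v ^ 2 := by
    intro i
    have hl0 := h0 (b i)
    have hl1 := h1 (b i)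
    rw [hq] at hl0 hl1
    rw [b.norm_eq_one, one_pow, mul_one] at hl1
    refine sq_le_of_momentum_recurrence hρ0 hρ1 hs hl0 hl1
      (a := fun k => inner ℝ (b i) ((momentumMap A s ^ k) (v, v)).1)
      (c := fun k => inner ℝ (b i) ((momentumMap A s ^ k) (v, v)).2) rfl ?_ ?_ k
    · intro k
      simp only [pow_succ', Module.End.mul_apply, momentumMap_apply]
      rw [← hA, hb, inner_smul_left, inner_sub_right, inner_smul_right, inner_smul_right]
      rfl
    · intro k
      simp only [pow_succ', Module.End.mul_apply, momentumMap_apply]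
  have hsq : ‖((momentumMap A s ^ k) (v, v)).1‖ ^ 2 ≤ 2 * s ^ k * ‖v‖ ^ 2 := by
    rw [← b.sum_sq_inner_right, ← b.sum_sq_inner_right v, mul_sum]
    exact sum_le_sum fun i _ => hcoord i
  refine abs_le_of_sq_le_sq' ?_ (by positivity) |>.2
  calc _ ≤ _ := hsq
    _ ≤ 4 * (s ^ k * ‖v‖ ^ 2) := by nlinarith [mul_nonneg (pow_nonneg hs0 k) (sq_nonneg ‖v‖)]
    _ = _ := by
      rw [mul_pow, mul_pow, ← pow_mul, mul_comm k 2, pow_mul, Real.sq_sqrt hs0]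
      norm_num

lemma iterate_affine_eq {F : Type*} [AddCommGroup F] [Module ℝ F] (M : F →ₗ[ℝ] F) {p e : ℕ → F}
    (h : ∀ t, p (t + 1) = M (p t) + e t) (t : ℕ) :
    p t = (M ^ t) (p 0) + ∑ i ∈ range t, (M ^ (t - 1 - i)) (e i) := by
  induction t with
  | zero => simp
  | succ t ih =>
    rw [h, ih, sum_range_succ, map_add, map_sum, pow_succ', Module.End.mul_apply, add_assoc]
    congr 2
    · refine sum_congr rfl fun i hi => ?_
      have : t + 1 - 1 - i = (t - 1 - i) + 1 := by have := mem_range.1 hi; omega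
      rw [this, pow_succ', Module.End.mul_apply]
    · simp

/-- Duhamel's formula: the same `u t` perturbs both components, so each perturbation restarts the
map from a diagonal pair and decays like the initial condition. Summing geometric series gives the
factor `1 / (1 - √s)`. -/
lemma sum_norm_momentum_le [FiniteDimensional ℝ E] {A : E →ₗ[ℝ] E} (hA : A.IsSymmetric)
    {ρ s η : ℝ} (hρ0 : 0 < ρ) (hρ1 : ρ < 1) (hs : s * (1 + ρ) = 1 - ρ)
    (h0 : ∀ v, 0 ≤ inner ℝ v (A v)) (h1 : ∀ v, inner ℝ v (A v) ≤ (1 - 2 * ρ ^ 2) * ‖v‖ ^ 2)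
    {y z u : ℕ → E} (hyz : z 0 = y 0) (hy : ∀ t, y (t + 1) = A ((1 + s) • y t - s • z t) + u t)
    (hz : ∀ t, z (t + 1) = y t + u t) (hu : ∀ t, ‖u t‖ ≤ η) (T : ℕ) :
    ∑ t ∈ range T, ‖y t‖ ≤ 2 * (‖y 0‖ + T * η) / (1 - √s) := by
  have hs1 : s < 1 := by nlinarith
  set r := √s with hr
  have hr0 : 0 ≤ r := Real.sqrt_nonneg s
  have hr1 : r < 1 := by rw [hr, Real.sqrt_lt' one_pos]; simpa using hs1
  have hη : 0 ≤ η := (norm_nonneg _).trans (hu 0)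
  have hgeom : ∀ t, ∑ i ∈ range t, r ^ i ≤ 1 / (1 - r) := fun t => by
    rw [le_div_iff₀ (by linarith), geom_sum_mul_neg]
    linarith [pow_nonneg hr0 t]
  have hpt : ∀ t, ‖y t‖ ≤ 2 * ‖y 0‖ * r ^ t + 2 * η * (1 / (1 - r)) := by
    intro t
    have h := congrArg Prod.fst (iterate_affine_eq (momentumMap A s)
      (p := fun t => (y t, z t)) (e := fun t => (u t, u t))
      (fun t => by simp [momentumMap_apply, hy, hz]) t)
    simp only [hyz, Prod.fst_add, Prod.fst_sum] at h
    rw [h]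
    refine (norm_add_le _ _).trans (add_le_add ?_ ?_)
    · refine (norm_momentumMap_pow_le hA hρ0 hρ1 hs h0 h1 t _).trans (le_of_eq ?_)
      ring
    · refine (norm_sum_le _ _).trans ?_
      calc ∑ i ∈ range t, ‖((momentumMap A s ^ (t - 1 - i)) (u i, u i)).1‖
          ≤ ∑ i ∈ range t, 2 * η * r ^ (t - 1 - i) := sum_le_sum fun i _ => by
            refine (norm_momentumMap_pow_le hA hρ0 hρ1 hs h0 h1 _ _).trans ?_
            have := mul_le_mul_of_nonneg_left (hu i) (pow_nonneg hr0 (t - 1 - i))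
            linarith
        _ = 2 * η * ∑ i ∈ range t, r ^ i := by
            rw [← mul_sum, sum_range_reflect (fun i => r ^ i) t]
        _ ≤ _ := mul_le_mul_of_nonneg_left (hgeom t) (by positivity)
  calc ∑ t ∈ range T, ‖y t‖
      ≤ ∑ t ∈ range T, (2 * ‖y 0‖ * r ^ t + 2 * η * (1 / (1 - r))) :=
        sum_le_sum fun t _ => hpt t
    _ = 2 * ‖y 0‖ * ∑ t ∈ range T, r ^ t + T * (2 * η * (1 / (1 - r))) := by
        rw [sum_add_distrib, ← mul_sum, sum_const, card_range, nsmul_eq_mul]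
    _ ≤ 2 * ‖y 0‖ * (1 / (1 - r)) + T * (2 * η * (1 / (1 - r))) := by
        have := mul_le_mul_of_nonneg_left (hgeom T) (by positivity : 0 ≤ 2 * ‖y 0‖)
        linarith
    _ = _ := by ring

end Momentum

/-! ### A Poincaré inequality with Metropolis weights -/

/-- The Metropolis weights `1 / max (d(i), d(j))` on the edges of `G`. -/
noncomputable def metropolisWeight {V : Type*} [Fintype V] (G : SimpleGraph V) [DecidableRel G.Adj]
    (i j : V) : ℝ :=
  if G.Adj i j then 1 / (max (G.degree i) (G.degree j) : ℝ) else 0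

section Metropolis

variable {V : Type*} [Fintype V] (G : SimpleGraph V) [DecidableRel G.Adj]

lemma metropolisWeight_comm (i j : V) : metropolisWeight G i j = metropolisWeight G j i := by
  simp only [metropolisWeight, G.adj_comm i j, max_comm]

lemma metropolisWeight_nonneg (i j : V) : 0 ≤ metropolisWeight G i j := by
  unfold metropolisWeight
  split_ifs <;> positivity

lemma sum_metropolisWeight_mul (i : V) (h : V → ℝ) :
    ∑ j, metropolisWeight G i j * h j
      = ∑ j ∈ G.neighborFinset i, h j / (max (G.degree i) (G.degree j) : ℝ) := by
  rw [SimpleGraph.neighborFinset_eq_filter, sum_filter]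
  refine sum_congr rfl fun j _ => ?_
  unfold metropolisWeight
  split_ifs <;> ring

lemma sum_metropolisWeight_le_one (i : V) : ∑ j, metropolisWeight G i j ≤ 1 := by
  have h := sum_metropolisWeight_mul G i (fun _ => 1)
  simp only [mul_one] at h
  rw [h]
  calc _ ≤ ∑ j ∈ G.neighborFinset i, 1 / (G.degree i : ℝ) := by
        refine sum_le_sum fun j hj => ?_
        have : 0 < G.degree i :=
          (G.degree_pos_iff_exists_adj i).2 ⟨j, (G.mem_neighborFinset i j).1 hj⟩
        have : (0 : ℝ) < G.degree i := by exact_mod_cast this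
        exact one_div_le_one_div_of_le this (le_max_left _ _)
    _ ≤ 1 := by
        rw [sum_const, SimpleGraph.card_neighborFinset_eq_degree, nsmul_eq_mul]
        rw [mul_one_div]
        exact div_self_le_one _

end Metropolis

section Poincare

variable {V : Type*} {G : SimpleGraph V}

/-- On a shortest walk, the prefix and suffix lengths bound the distances to the two ends, and the
triangle inequality forces equality. -/
lemma exists_seq_dist_eq (hG : G.Connected) (a b : V) :
    ∃ p : ℕ → V, p 0 = a ∧ p (G.dist a b) = b ∧ (∀ k ≤ G.dist a b, G.dist a (p k) = k) ∧
      ∀ k < G.dist a b, G.Adj (p k) (p (k + 1)) := by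
  obtain ⟨p, hp⟩ := hG.exists_walk_length_eq_dist a b
  refine ⟨p.getVert, p.getVert_zero, by rw [← hp, p.getVert_length], fun k hk => ?_,
    fun k hk => p.adj_getVert_succ (by omega)⟩
  have h1 := SimpleGraph.dist_le (p.take k)
  have h2 := SimpleGraph.dist_le (p.drop k)
  have h3 := hG.dist_triangle (u := a) (v := p.getVert k) (w := b)
  rw [SimpleGraph.Walk.take_length] at h1
  rw [SimpleGraph.Walk.drop_length] at h2
  omega

variable [Fintype V] [DecidableRel G.Adj]

/-- Double counting: the neighbours of a vertex `x` have distance to `a` within 1 of that of `x`,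
and the `p k` have distinct distances, so `x` is adjacent to at most three of them. -/
lemma sum_degree_geodesic_le (hG : G.Connected) {a : V} {D : ℕ} {p : ℕ → V}
    (hp : ∀ k ≤ D, G.dist a (p k) = k) :
    ∑ k ∈ range (D + 1), G.degree (p k) ≤ 3 * Fintype.card V := by
  classical
  calc ∑ k ∈ range (D + 1), G.degree (p k)
      = ∑ k ∈ range (D + 1), ∑ x : V, if G.Adj (p k) x then 1 else 0 := by
        refine sum_congr rfl fun k _ => ?_
        rw [← SimpleGraph.card_neighborFinset_eq_degree, SimpleGraph.neighborFinset_eq_filter,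
          card_filter]
    _ = ∑ x : V, ∑ k ∈ range (D + 1), if G.Adj (p k) x then 1 else 0 := sum_comm
    _ ≤ ∑ _x : V, 3 := by
        refine sum_le_sum fun x _ => ?_
        rw [← card_filter]
        calc _ ≤ (Finset.Icc (G.dist a x - 1) (G.dist a x + 1)).card := by
              refine card_le_card fun k hk => ?_
              obtain ⟨hk, hadj⟩ := mem_filter.1 hk
              have hk := hp k (by have := mem_range.1 hk; omega)
              have h1 : G.dist (p k) x = 1 := SimpleGraph.dist_eq_one_iff_adj.2 hadj
              have h2 := hG.dist_triangle (u := a) (v := p k) (w := x)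
              have h3 := hG.dist_triangle (u := a) (v := x) (w := p k)
              rw [SimpleGraph.dist_comm (u := x)] at h3
              rw [mem_Icc]
              omega
          _ ≤ 3 := by rw [Nat.card_Icc]; omega
    _ = 3 * Fintype.card V := by simp [mul_comm]

/-- Telescope along a geodesic and apply Cauchy–Schwarz with weights `m k`, the larger endpoint
degrees. As a maximum is at most the sum, these weights total at most `6n`. -/
lemma sq_sub_le_dirichlet (hG : G.Connected) (v : V → ℝ) (a b : V) :
    (v a - v b) ^ 2 ≤ 6 * Fintype.card V *
      ∑ i, ∑ j, metropolisWeight G i j * (v i - v j) ^ 2 := by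
  classical
  obtain ⟨p, hp0, hpD, hdist, hadj⟩ := exists_seq_dist_eq hG a b
  set D := G.dist a b
  let m : ℕ → ℝ := fun k => max (G.degree (p k)) (G.degree (p (k + 1)))
  have hm : ∀ k < D, 0 < m k := fun k hk => by
    have : 0 < G.degree (p k) := (G.degree_pos_iff_exists_adj _).2 ⟨_, hadj k hk⟩
    exact lt_max_of_lt_left (by exact_mod_cast this)
  have htel : v b - v a = ∑ k ∈ range D, (v (p (k + 1)) - v (p k)) := by
    rw [sum_range_sub (fun k => v (p k)), hp0, hpD]
  have hcs : (v b - v a) ^ 2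
      ≤ (∑ k ∈ range D, m k) * ∑ k ∈ range D, (v (p (k + 1)) - v (p k)) ^ 2 / m k := by
    rw [htel]
    refine sum_sq_le_sum_mul_sum_of_sq_le_mul _ (fun k hk => (hm k (mem_range.1 hk)).le)
      (fun k hk => div_nonneg (sq_nonneg _) (hm k (mem_range.1 hk)).le) fun k hk => ?_
    have := hm k (mem_range.1 hk)
    exact le_of_eq (by field_simp)
  have hsum : ∑ k ∈ range D, m k ≤ 6 * Fintype.card V := by
    have h1 : ∑ k ∈ range D, (G.degree (p k) : ℝ) ≤ 3 * Fintype.card V := by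
      have h := sum_degree_geodesic_le hG hdist
      rw [sum_range_succ] at h
      exact_mod_cast (Nat.le_add_right _ _).trans h
    have h2 : ∑ k ∈ range D, (G.degree (p (k + 1)) : ℝ) ≤ 3 * Fintype.card V := by
      have h := sum_degree_geodesic_le hG hdist
      rw [sum_range_succ'] at h
      exact_mod_cast (Nat.le_add_right _ _).trans h
    have h3 : ∑ k ∈ range D, m k
        ≤ ∑ k ∈ range D, ((G.degree (p k) : ℝ) + G.degree (p (k + 1))) :=
      sum_le_sum fun k _ => max_le_add_of_nonneg (Nat.cast_nonneg _) (Nat.cast_nonneg _)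
    rw [sum_add_distrib] at h3
    linarith
  have hdir : ∑ k ∈ range D, (v (p (k + 1)) - v (p k)) ^ 2 / m k
      ≤ ∑ i, ∑ j, metropolisWeight G i j * (v i - v j) ^ 2 := by
    rw [← Fintype.sum_prod_type' (fun i j => metropolisWeight G i j * (v i - v j) ^ 2)]
    -- Distances from `a` increase strictly along the path, so no ordered edge is used twice.
    have hinj : Set.InjOn (fun k => (p k, p (k + 1))) (range D : Set ℕ) := by
      intro k hk l hl h
      have hk := mem_range.1 hk
      have hl := mem_range.1 hl
      rw [← hdist k (by omega), ← hdist l (by omega), (Prod.mk.inj h).1]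
    calc _ = ∑ k ∈ range D, metropolisWeight G (p k) (p (k + 1)) * (v (p k) - v (p (k + 1))) ^ 2 :=
          sum_congr rfl fun k hk => by
            rw [metropolisWeight, if_pos (hadj k (mem_range.1 hk))]
            ring
      _ = ∑ q ∈ (range D).image (fun k => (p k, p (k + 1))),
            metropolisWeight G q.1 q.2 * (v q.1 - v q.2) ^ 2 := by rw [sum_image hinj]
      _ ≤ _ := sum_le_sum_of_subset_of_nonneg (subset_univ _) fun q _ _ =>
            mul_nonneg (metropolisWeight_nonneg G _ _) (sq_nonneg _)
  calc (v a - v b) ^ 2 = (v b - v a) ^ 2 := by ring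
    _ ≤ _ := hcs
    _ ≤ _ := mul_le_mul hsum hdir
      (sum_nonneg fun k hk => div_nonneg (sq_nonneg _) (hm k (mem_range.1 hk)).le) (by positivity)

end Poincare

lemma sum_sum_sq_sub {V : Type*} [Fintype V] (v : V → ℝ) :
    ∑ i, ∑ j, (v i - v j) ^ 2 = 2 * Fintype.card V * ∑ i, v i ^ 2 - 2 * (∑ i, v i) ^ 2 := by
  have : ∀ i j, (v i - v j) ^ 2 = v i ^ 2 + v j ^ 2 - 2 * (v i * v j) := fun i j => by ring
  simp only [this, sum_sub_distrib, sum_add_distrib, ← mul_sum, ← sum_mul, sum_const, card_univ,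
    nsmul_eq_mul]
  ring

lemma variance_le_dirichlet {V : Type*} [Fintype V] {G : SimpleGraph V} [DecidableRel G.Adj]
    (hG : G.Connected) (v : V → ℝ) :
    Fintype.card V * ∑ i, v i ^ 2 - (∑ i, v i) ^ 2 ≤ 3 * (Fintype.card V : ℝ) ^ 3 *
      ∑ i, ∑ j, metropolisWeight G i j * (v i - v j) ^ 2 := by
  have h : ∑ i, ∑ j, (v i - v j) ^ 2 ≤ ∑ _i : V, ∑ _j : V, 6 * (Fintype.card V : ℝ) *
      ∑ i, ∑ j, metropolisWeight G i j * (v i - v j) ^ 2 :=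
    sum_le_sum fun i _ => sum_le_sum fun j _ => sq_sub_le_dirichlet hG v i j
  rw [sum_sum_sq_sub] at h
  simp only [sum_const, card_univ, nsmul_eq_mul] at h
  linarith

lemma dirichlet_le {V : Type*} [Fintype V] (G : SimpleGraph V) [DecidableRel G.Adj]
    (v : V → ℝ) (c : ℝ) :
    ∑ i, ∑ j, metropolisWeight G i j * (v i - v j) ^ 2 ≤ 4 * ∑ i, (v i - c) ^ 2 := by
  have h1 : ∑ i, ∑ j, metropolisWeight G i j * (v i - v j) ^ 2
      ≤ ∑ i, ∑ j, (2 * (metropolisWeight G i j * (v i - c) ^ 2)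
        + 2 * (metropolisWeight G i j * (v j - c) ^ 2)) := by
    refine sum_le_sum fun i _ => sum_le_sum fun j _ => ?_
    have := mul_nonneg (metropolisWeight_nonneg G i j) (sq_nonneg (v i - c + (v j - c)))
    linear_combination this
  have h2 : ∑ i, ∑ j, metropolisWeight G i j * (v i - c) ^ 2 ≤ ∑ i, (v i - c) ^ 2 := by
    refine sum_le_sum fun i _ => ?_
    rw [← sum_mul]
    exact mul_le_of_le_one_left (sq_nonneg _) (sum_metropolisWeight_le_one G i)
  have h3 : ∑ i, ∑ j, metropolisWeight G i j * (v j - c) ^ 2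
      = ∑ i, ∑ j, metropolisWeight G i j * (v i - c) ^ 2 := by
    rw [sum_comm]
    refine sum_congr rfl fun i _ => sum_congr rfl fun j _ => ?_
    rw [metropolisWeight_comm]
  simp only [sum_add_distrib, ← mul_sum] at h1
  linarith

/-! ### Means and medians -/

section Mean

variable {n : ℕ}

lemma mean_add (u v : Fin n → ℝ) : mean (fun i => u i + v i) = mean u + mean v := by
  simp only [mean, sum_add_distrib, mul_add]

lemma mean_sub (u v : Fin n → ℝ) : mean (fun i => u i - v i) = mean u - mean v := by
  simp only [mean, sum_sub_distrib, mul_sub]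

lemma mean_const_mul (c : ℝ) (v : Fin n → ℝ) : mean (fun i => c * v i) = c * mean v := by
  simp only [mean, ← mul_sum]
  ring

lemma mean_const (hn : 0 < n) (c : ℝ) : mean (fun _ : Fin n => c) = c := by
  have : (n : ℝ) ≠ 0 := by positivity
  simp only [mean, sum_const, card_univ, Fintype.card_fin, nsmul_eq_mul]
  field_simp

lemma mean_sum {ι : Type*} (S : Finset ι) (v : ι → Fin n → ℝ) :
    mean (fun i => ∑ k ∈ S, v k i) = ∑ k ∈ S, mean (v k) := by
  simp only [mean]
  rw [sum_comm, mul_sum]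

lemma mean_mono {u v : Fin n → ℝ} (h : ∀ i, u i ≤ v i) : mean u ≤ mean v :=
  mul_le_mul_of_nonneg_left (sum_le_sum fun i _ => h i) (by positivity)

lemma abs_mean_le (v : Fin n → ℝ) : |mean v| ≤ mean (fun i => |v i|) := by
  rw [mean, abs_mul, abs_of_nonneg (by positivity : (0 : ℝ) ≤ 1 / n)]
  exact mul_le_mul_of_nonneg_left (abs_sum_le_sum_abs _ _) (by positivity)

lemma abs_mean_le_of_forall (hn : 0 < n) {v : Fin n → ℝ} {c : ℝ} (h : ∀ i, |v i| ≤ c) :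
    |mean v| ≤ c :=
  (abs_mean_le v).trans ((mean_mono h).trans (mean_const hn c).le)

/-- Pair each sorted entry with its mirror image. The median lies between the two, so it minimizes
the sum of distances to each pair. -/
lemma sum_abs_sub_median_le (hn : 0 < n) (θ : Fin n → ℝ) (c : ℝ) :
    ∑ i, |θ i - median θ| ≤ ∑ i, |θ i - c| := by
  set s := θ ∘ Tuple.sort θ with hs
  have hmono : Monotone s := Tuple.monotone_sort θ
  have hm : median θ = (s ⟨(n - 1) / 2, by omega⟩ + s ⟨n / 2, by omega⟩) / 2 := by
    simp only [median, dif_pos hn, hs]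
  set m := median θ
  have hsort : ∀ b, ∑ i, |θ i - b| = ∑ i, |s i - b| := fun b =>
    (Equiv.sum_comp (Tuple.sort θ) (fun i => |θ i - b|)).symm
  have hrev : ∀ b, ∑ i, |s i - b| = ∑ i : Fin n, |s i.rev - b| := fun b =>
    (Equiv.sum_comp Fin.revPerm (fun i => |s i - b|)).symm
  have hmid : s ⟨(n - 1) / 2, by omega⟩ ≤ s ⟨n / 2, by omega⟩ :=
    hmono (by simp only [Fin.mk_le_mk]; omega)
  have hlow : ∀ i : Fin n, i.val ≤ (n - 1) / 2 → s i ≤ m ∧ m ≤ s i.rev := by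
    intro i hi
    have h1 : s i ≤ s ⟨(n - 1) / 2, by omega⟩ := hmono (by simpa [Fin.le_def] using hi)
    have h2 : s ⟨n / 2, by omega⟩ ≤ s i.rev :=
      hmono (by rw [Fin.le_def, Fin.val_rev]; simp only; omega)
    constructor <;> linarith
  have hpair : ∀ i : Fin n, |s i - m| + |s i.rev - m| ≤ |s i - c| + |s i.rev - c| := by
    intro i
    rcases le_or_gt i.val ((n - 1) / 2) with hi | hi
    · obtain ⟨h1, h2⟩ := hlow i hi
      rw [abs_of_nonpos (by linarith : s i - m ≤ 0), abs_of_nonneg (by linarith : 0 ≤ s i.rev - m)]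
      linarith [neg_abs_le (s i - c), le_abs_self (s i.rev - c)]
    · obtain ⟨h1, h2⟩ := hlow i.rev (by rw [Fin.val_rev]; omega)
      rw [Fin.rev_rev] at h2
      rw [abs_of_nonneg (by linarith : 0 ≤ s i - m), abs_of_nonpos (by linarith : s i.rev - m ≤ 0)]
      linarith [neg_abs_le (s i.rev - c), le_abs_self (s i - c)]
  have := sum_le_sum fun i (_ : i ∈ univ) => hpair i
  rw [sum_add_distrib, sum_add_distrib, ← hrev, ← hrev] at this
  rw [hsort, hsort]
  linarith

lemma disp_le_mean_abs_sub (hn : 0 < n) (θ : Fin n → ℝ) (c : ℝ) :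
    disp θ ≤ mean (fun i => |θ i - c|) :=
  mul_le_mul_of_nonneg_left (sum_abs_sub_median_le hn θ c) (by positivity)

lemma norm_sq_toLp (v : Fin n → ℝ) : ‖(WithLp.toLp 2 v : EuclideanSpace ℝ (Fin n))‖ ^ 2
    = ∑ i, v i ^ 2 := by
  simp [EuclideanSpace.norm_sq_eq]

lemma mean_abs_le_norm (hn : 0 < n) (v : Fin n → ℝ) :
    mean (fun i => |v i|) ≤ ‖(WithLp.toLp 2 v : EuclideanSpace ℝ (Fin n))‖ / √n := by
  have hn' : (0 : ℝ) < n := by exact_mod_cast hn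
  have hcs : (∑ i, |v i|) ^ 2 ≤ n * ∑ i, |v i| ^ 2 := by
    simpa using sq_sum_le_card_mul_sum_sq (s := univ) (f := fun i => |v i|)
  simp only [sq_abs, ← norm_sq_toLp] at hcs
  have h : ∑ i, |v i| ≤ √n * ‖(WithLp.toLp 2 v : EuclideanSpace ℝ (Fin n))‖ := by
    refine abs_le_of_sq_le_sq' ?_ (by positivity) |>.2
    rwa [mul_pow, Real.sq_sqrt hn'.le]
  rw [mean, le_div_iff₀ (by positivity)]
  calc 1 / (n : ℝ) * (∑ i, |v i|) * √n
      ≤ 1 / (n : ℝ) * (√n * ‖(WithLp.toLp 2 v : EuclideanSpace ℝ (Fin n))‖) * √n := by gcongr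
    _ = (√n * √n) / n * ‖(WithLp.toLp 2 v : EuclideanSpace ℝ (Fin n))‖ := by ring
    _ = _ := by rw [Real.mul_self_sqrt hn'.le, div_self hn'.ne', one_mul]

end Mean

/-! ### Subgradients -/

lemma exists_isSubgradient {f : ℝ → ℝ} (hf : ConvexOn ℝ Set.univ f) (θ : ℝ) :
    ∃ g, IsSubgradient f θ g := by
  have hint : θ ∈ interior (Set.univ : Set ℝ) := by simp
  refine ⟨derivWithin f (Set.Ioi θ) θ, fun w => ?_⟩
  rcases lt_trichotomy w θ with h | rfl | h
  · have h1 := (hf.slope_le_leftDeriv_of_mem_interior (Set.mem_univ w) hint h).trans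
      (hf.leftDeriv_le_rightDeriv_of_mem_interior hint)
    rw [slope_def_field, div_le_iff₀ (by linarith)] at h1
    linarith
  · simp
  · have h1 := hf.rightDeriv_le_slope_of_mem_interior hint (Set.mem_univ w) h
    rw [slope_def_field, le_div_iff₀ (by linarith)] at h1
    linarith

lemma sub_le_mul_abs_sub_of_subgradient_bounded {f : ℝ → ℝ} (hf : ConvexOn ℝ Set.univ f) {L : ℝ}
    (hL : ∀ θ s, IsSubgradient f θ s → |s| ≤ L) (a b : ℝ) : f a - f b ≤ L * |a - b| := by
  obtain ⟨g, hg⟩ := exists_isSubgradient hf a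
  have h1 := hg b
  have h2 : g * (a - b) ≤ |g| * |a - b| := (le_abs_self _).trans (abs_mul _ _).le
  have h3 := mul_le_mul_of_nonneg_right (hL a g hg) (abs_nonneg (a - b))
  linarith

/-! ### The gossip operator on deviations from the mean -/

section Gossip

variable {n : ℕ} (G : SimpleGraph (Fin n)) [DecidableRel G.Adj]

/-- Summation by parts, from the symmetry of the weights. It yields both the symmetry of the gossip
operator and conservation of the mean. -/
lemma sum_mul_sum_metropolisWeight_sub (u v : Fin n → ℝ) :
    ∑ i, u i * ∑ j, metropolisWeight G i j * (v j - v i)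
      = -(1 / 2) * ∑ i, ∑ j, metropolisWeight G i j * ((u i - u j) * (v i - v j)) := by
  have h1 : ∑ i, u i * ∑ j, metropolisWeight G i j * (v j - v i)
      = ∑ i, ∑ j, metropolisWeight G i j * (u i * (v j - v i)) := by
    refine sum_congr rfl fun i _ => ?_
    rw [mul_sum]
    exact sum_congr rfl fun j _ => by ring
  have h2 : ∑ i, ∑ j, metropolisWeight G i j * (u i * (v j - v i))
      = ∑ i, ∑ j, metropolisWeight G i j * (u j * (v i - v j)) := by
    rw [sum_comm]
    refine sum_congr rfl fun i _ => sum_congr rfl fun j _ => ?_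
    rw [metropolisWeight_comm]
  have h3 : ∑ i, ∑ j, metropolisWeight G i j * ((u i - u j) * (v i - v j))
      = -(∑ i, ∑ j, metropolisWeight G i j * (u i * (v j - v i))
        + ∑ i, ∑ j, metropolisWeight G i j * (u j * (v i - v j))) := by
    simp only [← sum_add_distrib, ← sum_neg_distrib]
    exact sum_congr rfl fun i _ => sum_congr rfl fun j _ => by ring
  rw [h3, ← h2, h1]
  ring

lemma mean_sum_metropolisWeight_sub (v : Fin n → ℝ) :
    mean (fun i => ∑ j, metropolisWeight G i j * (v j - v i)) = 0 := by
  have h := sum_mul_sum_metropolisWeight_sub G (fun _ => 1) v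
  simp only [one_mul, sub_self, zero_mul, mul_zero, sum_const_zero] at h
  rw [mean, h, mul_zero]

/-- One lazy Metropolis averaging step, followed by subtraction of the mean. -/
noncomputable def deviationMap : EuclideanSpace ℝ (Fin n) →ₗ[ℝ] EuclideanSpace ℝ (Fin n) where
  toFun v := WithLp.toLp 2 fun i =>
    v i + 1 / 2 * ∑ j, metropolisWeight G i j * (v j - v i) - mean v
  map_add' u v := by
    ext i
    have h : ∑ j, metropolisWeight G i j * (u j + v j - (u i + v i))
        = ∑ j, metropolisWeight G i j * (u j - u i)
          + ∑ j, metropolisWeight G i j * (v j - v i) := by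
      rw [← sum_add_distrib]
      exact sum_congr rfl fun j _ => by ring
    have hm : mean (u + v).ofLp = mean u.ofLp + mean v.ofLp := mean_add u.ofLp v.ofLp
    simp only [PiLp.add_apply, h, hm]
    ring
  map_smul' c v := by
    ext i
    have h : ∑ j, metropolisWeight G i j * (c * v j - c * v i)
        = c * ∑ j, metropolisWeight G i j * (v j - v i) := by
      rw [mul_sum]
      exact sum_congr rfl fun j _ => by ring
    have hm : mean (c • v).ofLp = c * mean v.ofLp := mean_const_mul c v.ofLp
    simp only [PiLp.smul_apply, smul_eq_mul, h, hm, RingHom.id_apply]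
    ring

lemma deviationMap_apply (v : EuclideanSpace ℝ (Fin n)) (i : Fin n) :
    deviationMap G v i = v i + 1 / 2 * ∑ j, metropolisWeight G i j * (v j - v i) - mean v := rfl

lemma inner_deviationMap (u v : EuclideanSpace ℝ (Fin n)) :
    inner ℝ u (deviationMap G v) = ∑ i, u i * v i
      - 1 / 4 * ∑ i, ∑ j, metropolisWeight G i j * ((u i - u j) * (v i - v j))
      - 1 / n * ((∑ i, u i) * ∑ i, v i) := by
  have h := sum_mul_sum_metropolisWeight_sub G u v
  have e : inner ℝ u (deviationMap G v) = ∑ i, u i * deviationMap G v i := by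
    rw [PiLp.inner_apply]
    exact sum_congr rfl fun i _ => mul_comm _ _
  have e2 : ∀ i, u i * deviationMap G v i = u i * v i
      + 1 / 2 * (u i * ∑ j, metropolisWeight G i j * (v j - v i)) - u i * mean v := fun i => by
    rw [deviationMap_apply]
    ring
  rw [e]
  simp only [e2, sum_sub_distrib, sum_add_distrib, ← mul_sum, ← sum_mul, h, mean]
  ring

lemma deviationMap_isSymmetric : (deviationMap G).IsSymmetric := by
  intro u v
  rw [real_inner_comm, inner_deviationMap, inner_deviationMap]
  simp only [mul_comm]

lemma inner_deviationMap_self (v : EuclideanSpace ℝ (Fin n)) :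
    inner ℝ v (deviationMap G v) = ‖v‖ ^ 2
      - 1 / 4 * ∑ i, ∑ j, metropolisWeight G i j * (v i - v j) ^ 2
      - 1 / n * (∑ i, v i) ^ 2 := by
  rw [inner_deviationMap, EuclideanSpace.real_norm_sq_eq]
  simp only [← sq]

/-- The factor 1/2 in the averaging step (laziness) keeps the spectrum nonnegative: a quarter of the
Dirichlet form is at most the squared deviation from the mean. -/
lemma inner_deviationMap_self_nonneg (v : EuclideanSpace ℝ (Fin n)) :
    0 ≤ inner ℝ v (deviationMap G v) := by
  rcases Nat.eq_zero_or_pos n with rfl | hn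
  · simp [Subsingleton.elim v 0]
  have hn' : (n : ℝ) ≠ 0 := by positivity
  have h := dirichlet_le G v (1 / n * ∑ i, v i)
  have e : ∑ i, (v i - 1 / n * ∑ i, v i) ^ 2 = ‖v‖ ^ 2 - 1 / n * (∑ i, v i) ^ 2 := by
    rw [EuclideanSpace.real_norm_sq_eq]
    simp only [sub_sq, sum_sub_distrib, sum_add_distrib, sum_const, card_univ, Fintype.card_fin,
      nsmul_eq_mul, ← sum_mul, ← mul_sum]
    field_simp
    ring
  rw [e] at h
  rw [inner_deviationMap_self]
  linarith

/-- Subtracting the mean sends constants to 0, so the Poincaré gap holds on the whole space and not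
only on mean-zero vectors. -/
lemma inner_deviationMap_self_le {G : SimpleGraph (Fin n)} [DecidableRel G.Adj]
    (hG : G.Connected) (v : EuclideanSpace ℝ (Fin n)) :
    inner ℝ v (deviationMap G v) ≤ (1 - 1 / (12 * (n : ℝ) ^ 2)) * ‖v‖ ^ 2 := by
  have hn : 0 < n := Fin.pos_iff_nonempty.2 hG.nonempty
  have hn' : (1 : ℝ) ≤ n := by exact_mod_cast hn
  have h := variance_le_dirichlet hG v
  rw [Fintype.card_fin, ← EuclideanSpace.real_norm_sq_eq] at h
  rw [inner_deviationMap_self]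
  set F := ∑ i, ∑ j, metropolisWeight G i j * (v i - v j) ^ 2
  set S := (∑ i, v i) ^ 2
  have hS : 0 ≤ S := sq_nonneg _
  have h2 : 1 / (12 * (n : ℝ) ^ 2) * ‖v‖ ^ 2 ≤ 1 / 4 * F + 1 / n * S := by
    have hS2 : S ≤ 12 * (n : ℝ) ^ 2 * S := le_mul_of_one_le_left hS (by nlinarith)
    have e : 1 / 4 * F + 1 / n * S
        = (3 * (n : ℝ) ^ 3 * F + 12 * (n : ℝ) ^ 2 * S) / (12 * (n : ℝ) ^ 3) := by
      field_simp
      ring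
    rw [e, le_div_iff₀ (by positivity)]
    calc 1 / (12 * (n : ℝ) ^ 2) * ‖v‖ ^ 2 * (12 * (n : ℝ) ^ 3) = n * ‖v‖ ^ 2 := by field_simp
      _ ≤ _ := by linarith
  linarith

end Gossip

/-! ### Protocol runs -/

namespace IsProtocolRun

variable {n : ℕ} {G : SimpleGraph (Fin n)} [DecidableRel G.Adj] {f : Fin n → ℝ → ℝ} {U β : ℝ}
  {x y z g : ℕ → Fin n → ℝ}

lemma y_succ (h : IsProtocolRun G f U β x y z g) {t : ℕ} (ht : 1 ≤ t) (i : Fin n) :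
    y (t + 1) i = x t i + 1 / 2 * ∑ j, metropolisWeight G i j * (x t j - x t i) - β * g t i := by
  rw [h.update_y t ht, sum_metropolisWeight_mul G i (fun j => x t j - x t i)]

/-- The update rule gives this only from time 2 on. At time 1 it holds because `x`, `y`, `z`
coincide and the coefficients sum to 1. -/
lemma x_eq (h : IsProtocolRun G f U β x y z g) {t : ℕ} (ht : 1 ≤ t) (i : Fin n) :
    x t i = (1 + (1 - 2 / (9 * U + 1))) * y t i - (1 - 2 / (9 * U + 1)) * z t i := by
  obtain ⟨t, rfl⟩ := Nat.exists_eq_add_of_le' ht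
  rcases Nat.eq_zero_or_pos t with rfl | h0
  · rw [h.init_y, h.init_z]
    ring
  · rw [h.update_x t h0]
    ring

lemma mean_y_succ_eq_sub (h : IsProtocolRun G f U β x y z g) {t : ℕ} (ht : 1 ≤ t) :
    mean (y (t + 1)) = mean (x t) - β * mean (g t) := by
  have : y (t + 1) = fun i => x t i
      + 1 / 2 * (∑ j, metropolisWeight G i j * (x t j - x t i)) - β * g t i :=
    funext (h.y_succ ht)
  rw [this, mean_sub, mean_add, mean_const_mul, mean_const_mul, mean_sum_metropolisWeight_sub]
  ring

lemma mean_z_succ (h : IsProtocolRun G f U β x y z g) {t : ℕ} (ht : 1 ≤ t) :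
    mean (z (t + 1)) = mean (y t) - β * mean (g t) := by
  rw [show z (t + 1) = fun i => y t i - β * g t i from funext (h.update_z t ht), mean_sub,
    mean_const_mul]

lemma mean_x (h : IsProtocolRun G f U β x y z g) {t : ℕ} (ht : 1 ≤ t) :
    mean (x t) = (1 + (1 - 2 / (9 * U + 1))) * mean (y t) - (1 - 2 / (9 * U + 1)) * mean (z t) := by
  rw [show x t = _ from funext (h.x_eq ht), mean_sub, mean_const_mul, mean_const_mul]

lemma mean_z_eq_mean_y (h : IsProtocolRun G f U β x y z g) {t : ℕ} (ht : 1 ≤ t) :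
    mean (z t) = mean (y t) := by
  induction t, ht using Nat.le_induction with
  | base => rw [show z 1 = x 1 from funext h.init_z, show y 1 = x 1 from funext h.init_y]
  | succ t ht ih =>
    rw [h.mean_z_succ ht, h.mean_y_succ_eq_sub ht, h.mean_x ht, ih]
    ring

lemma mean_x_eq_mean_y (h : IsProtocolRun G f U β x y z g) {t : ℕ} (ht : 1 ≤ t) :
    mean (x t) = mean (y t) := by
  rw [h.mean_x ht, h.mean_z_eq_mean_y ht]
  ring

lemma mean_y_succ (h : IsProtocolRun G f U β x y z g) {t : ℕ} (ht : 1 ≤ t) :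
    mean (y (t + 1)) = mean (y t) - β * mean (g t) := by
  rw [h.mean_y_succ_eq_sub ht, h.mean_x_eq_mean_y ht]

lemma sum_deviation_le (h : IsProtocolRun G f U β x y z g) (hG : G.Connected) (hU : (n : ℝ) ≤ U)
    {L : ℝ} (hβ : 0 ≤ β) (hL : ∀ i θ s, IsSubgradient (f i) θ s → |s| ≤ L) (T : ℕ) :
    ∑ t ∈ range T, l2Dev (y (t + 1)) (mean (y (t + 1)))
      ≤ 20 * U * (l2Dev (y 1) (mean (y 1)) + T * (√n * (2 * β * L))) := by
  have hn : 0 < n := Fin.pos_iff_nonempty.2 hG.nonempty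
  have hn' : (1 : ℝ) ≤ n := by exact_mod_cast hn
  have hU1 : 1 ≤ U := hn'.trans hU
  set s := 1 - 2 / (9 * U + 1) with hs
  have hs0 : 0 ≤ s := by
    rw [hs, sub_nonneg, div_le_one (by linarith)]
    linarith
  have hρ1 : 1 / (9 * U) < 1 := by
    rw [div_lt_one (by linarith)]
    linarith
  -- The momentum parameter of the protocol is `(1 - ρ)/(1 + ρ)` with `ρ = 1/(9U)`. The next
  -- inequality, `2ρ² ≤ 1/(12 n²)`, reduces to `24 n² ≤ 81 U²`.
  have hsρ : s * (1 + 1 / (9 * U)) = 1 - 1 / (9 * U) := by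
    rw [hs]
    field_simp
    ring
  have hgap : 2 * (1 / (9 * U)) ^ 2 ≤ 1 / (12 * (n : ℝ) ^ 2) := by
    rw [div_pow, one_pow, mul_one_div, div_le_div_iff₀ (by positivity) (by positivity)]
    nlinarith
  let d : ℕ → EuclideanSpace ℝ (Fin n) := fun t =>
    WithLp.toLp 2 fun i => y (t + 1) i - mean (y (t + 1))
  -- Subtracting the mean of `y` suffices here, since `z` has the same mean.
  let e : ℕ → EuclideanSpace ℝ (Fin n) := fun t =>
    WithLp.toLp 2 fun i => z (t + 1) i - mean (y (t + 1))
  let u : ℕ → EuclideanSpace ℝ (Fin n) := fun t =>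
    WithLp.toLp 2 fun i => -(β * (g (t + 1) i - mean (g (t + 1))))
  have hg : ∀ t i, |g (t + 1) i| ≤ L := fun t i =>
    hL i _ _ (h.subgradient (t + 1) (by omega) i)
  have hL0 : 0 ≤ L := (abs_nonneg _).trans (hg 0 ⟨0, hn⟩)
  have hu : ∀ t, ‖u t‖ ≤ √n * (2 * β * L) := by
    intro t
    refine abs_le_of_sq_le_sq' ?_ (by positivity) |>.2
    rw [norm_sq_toLp, mul_pow, Real.sq_sqrt (by positivity)]
    calc ∑ i, (-(β * (g (t + 1) i - mean (g (t + 1))))) ^ 2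
        ≤ ∑ _i : Fin n, (2 * β * L) ^ 2 := sum_le_sum fun i _ => by
          refine sq_le_sq' ?_ ?_ <;>
          · have h1 := abs_le.1 (hg t i)
            have h2 := abs_le.1 (abs_mean_le_of_forall hn (hg t))
            have h3 := mul_le_mul_of_nonneg_left
              (by linarith : g (t + 1) i - mean (g (t + 1)) ≤ 2 * L) hβ
            have h4 := mul_le_mul_of_nonneg_left
              (by linarith : -(2 * L) ≤ g (t + 1) i - mean (g (t + 1))) hβ
            linarith
      _ = _ := by simp
  have hd : ∀ t, d (t + 1) = deviationMap G ((1 + s) • d t - s • e t) + u t := by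
    intro t
    have hx : ((1 + s) • d t - s • e t : EuclideanSpace ℝ (Fin n))
        = WithLp.toLp 2 fun i => x (t + 1) i - mean (y (t + 1)) := by
      ext i
      simp only [d, e, PiLp.sub_apply, PiLp.smul_apply, smul_eq_mul, h.x_eq (Nat.le_add_left 1 t) i]
      ring
    ext i
    rw [hx, PiLp.add_apply, deviationMap_apply]
    simp only [d, u, mean_sub, mean_const hn, h.mean_x_eq_mean_y (Nat.le_add_left 1 t),
      h.mean_y_succ (Nat.le_add_left 1 t), h.y_succ (Nat.le_add_left 1 t) i, sub_sub_sub_cancel_right]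
    ring
  have he : ∀ t, e (t + 1) = d t + u t := by
    intro t
    ext i
    simp only [d, e, u, PiLp.add_apply, h.mean_y_succ (Nat.le_add_left 1 t),
      h.update_z (t + 1) (Nat.le_add_left 1 t) i]
    ring
  have he0 : e 0 = d 0 := by
    ext i
    simp only [d, e, zero_add, h.init_y, h.init_z]
  have hmain := sum_norm_momentum_le (deviationMap_isSymmetric G) (by positivity) hρ1 hsρ
    (inner_deviationMap_self_nonneg G)
    (fun v => (inner_deviationMap_self_le hG v).trans
      (mul_le_mul_of_nonneg_right (by linarith) (sq_nonneg _))) he0 hd he hu T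
  refine hmain.trans ?_
  have hsqrt : 1 / (9 * U + 1) ≤ 1 - √s := by
    have h1 : √s ≤ (1 + s) / 2 := by
      rw [Real.sqrt_le_left (by linarith)]
      nlinarith [sq_nonneg (1 - s)]
    have h2 : (1 - s) / 2 = 1 / (9 * U + 1) := by
      rw [hs]
      ring
    linarith
  have hpos : 0 < 1 / (9 * U + 1) := by positivity
  rw [div_le_iff₀ (by linarith)]
  -- Uses `9U + 1 ≤ 10U`, that is, `U ≥ 1`.
  have hone : 1 ≤ 10 * U * (1 - √s) := by
    refine le_trans ?_ (mul_le_mul_of_nonneg_left hsqrt (by positivity))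
    rw [mul_one_div, le_div_iff₀ (by positivity)]
    linarith
  have := mul_le_mul_of_nonneg_left hone
    (by positivity : 0 ≤ 2 * (‖d 0‖ + T * (√n * (2 * β * L))))
  calc 2 * (‖d 0‖ + T * (√n * (2 * β * L)))
      ≤ 2 * (‖d 0‖ + T * (√n * (2 * β * L))) * (10 * U * (1 - √s)) := by linarith
    _ = 20 * U * (‖d 0‖ + T * (√n * (2 * β * L))) * (1 - √s) := by ring
    _ = _ := rfl

lemma avg_mean_abs_deviation_le {C L : ℝ} {T : ℕ}
    (h : IsProtocolRun G f U (1 / (L * √(U * T))) x y z g) (hG : G.Connected)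
    (hU : (n : ℝ) ≤ U) (hUC : U ≤ C * n) (hL0 : 0 < L)
    (hL : ∀ i θ s, IsSubgradient (f i) θ s → |s| ≤ L) (hT : 1 ≤ T) :
    1 / (T : ℝ) * ∑ t ∈ Icc 1 T, mean (fun i => |y t i - mean (y t)|)
      ≤ 40 * C * (√(n / T) * (l2Dev (y 1) (mean (x 1)) / √T + 1)) := by
  have hn : 0 < n := Fin.pos_iff_nonempty.2 hG.nonempty
  have hn' : (0 : ℝ) < n := by exact_mod_cast hn
  have hT' : (0 : ℝ) < T := by exact_mod_cast hT
  have hU0 : 0 < U := hn'.trans_le hU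
  have hC : 0 ≤ C := le_of_lt (pos_of_mul_pos_left (hU0.trans_le hUC) hn'.le)
  have hsum := h.sum_deviation_le hG hU (by positivity) hL T
  rw [show y 1 = x 1 from funext h.init_y] at hsum ⊢
  set N := l2Dev (x 1) (mean (x 1)) with hN
  have hN0 : 0 ≤ N := norm_nonneg _
  -- The choice of `β` makes the noise per step `2√n/√(UT)`, and `n ≤ U` removes the dependence on
  -- `n`.
  have hnoise : √n * (2 * (1 / (L * √(U * T))) * L) ≤ 2 / √T := by
    have h1 : √n ≤ √U := Real.sqrt_le_sqrt hU
    have h2 : 0 < √U := Real.sqrt_pos.2 hU0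
    have h3 : 0 < √(T : ℝ) := Real.sqrt_pos.2 hT'
    rw [Real.sqrt_mul hU0.le]
    have e : √n * (2 * (1 / (L * (√U * √T))) * L) = (√n / √U) * (2 / √T) := by
      field_simp
    rw [e]
    exact mul_le_of_le_one_left (by positivity) ((div_le_one h2).2 h1)
  have hshift : ∑ t ∈ Icc 1 T, mean (fun i => |y t i - mean (y t)|)
      = ∑ t ∈ range T, mean (fun i => |y (t + 1) i - mean (y (t + 1))|) := by
    rw [range_eq_Ico, sum_Ico_add' (fun t => mean (fun i => |y t i - mean (y t)|)) 0 T 1]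
    rfl
  have hle : ∑ t ∈ range T, mean (fun i => |y (t + 1) i - mean (y (t + 1))|)
      ≤ (20 * U * (N + T * (2 / √T))) / √n := by
    calc _ ≤ ∑ t ∈ range T, l2Dev (y (t + 1)) (mean (y (t + 1))) / √n :=
          sum_le_sum fun t _ => mean_abs_le_norm hn _
      _ = (∑ t ∈ range T, l2Dev (y (t + 1)) (mean (y (t + 1)))) / √n := by rw [sum_div]
      _ ≤ _ := by
          refine div_le_div_of_nonneg_right (hsum.trans ?_) (Real.sqrt_nonneg _)
          gcongr
  rw [hshift]
  have hsn : 0 < √(n : ℝ) := Real.sqrt_pos.2 hn'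
  have hsT : 0 < √(T : ℝ) := Real.sqrt_pos.2 hT'
  have en : √(n : ℝ) * √n = n := Real.mul_self_sqrt hn'.le
  have eT : √(T : ℝ) * √T = T := Real.mul_self_sqrt hT'.le
  calc _ ≤ 1 / (T : ℝ) * ((20 * U * (N + T * (2 / √T))) / √n) := by gcongr
    _ ≤ 1 / (T : ℝ) * ((20 * (C * n) * (N + T * (2 / √T))) / √n) := by gcongr
    _ = 20 * C * ((√n / √T) * (N / √T + 2)) := by
        have alg : ∀ a b : ℝ, 0 < a → 0 < b →
            1 / (b * b) * (20 * (C * (a * a)) * (N + b * b * (2 / b)) / a)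
              = 20 * C * (a / b * (N / b + 2)) := fun a b ha hb => by field_simp
        have := alg _ _ hsn hsT
        rwa [en, eT] at this
    _ ≤ 20 * C * ((√n / √T) * (2 * (N / √T + 1))) := by
        have : 0 ≤ N / √T := by positivity
        gcongr
        linarith
    _ = _ := by
        rw [Real.sqrt_div hn'.le]
        ring

/-- Expand the square of the averaged step. Writing `y t i - w` as deviation from the mean plus
`mean (y t) - w`, the first part costs at most `L` times the deviation. -/
lemma two_mul_mean_sub_le (h : IsProtocolRun G f U β x y z g) (hn : 0 < n) (hβ : 0 ≤ β) {L : ℝ}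
    (hL : ∀ i θ s, IsSubgradient (f i) θ s → |s| ≤ L) (w : ℝ) {t : ℕ} (ht : 1 ≤ t) :
    2 * β * (mean (fun i => f i (y t i)) - objective f w)
      ≤ (mean (y t) - w) ^ 2 - (mean (y (t + 1)) - w) ^ 2 + β ^ 2 * L ^ 2
        + 2 * β * (L * mean (fun i => |y t i - mean (y t)|)) := by
  have hg : ∀ i, |g t i| ≤ L := fun i => hL i _ _ (h.subgradient t ht i)
  have hpt : ∀ i, f i (y t i) - f i w - L * |y t i - mean (y t)| ≤ (mean (y t) - w) * g t i := by
    intro i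
    have h1 := h.subgradient t ht i w
    have h2 : g t i * (y t i - mean (y t)) ≤ |g t i| * |y t i - mean (y t)| :=
      (le_abs_self _).trans (abs_mul _ _).le
    have h3 := mul_le_mul_of_nonneg_right (hg i) (abs_nonneg (y t i - mean (y t)))
    linarith
  have hmean := mean_mono hpt
  rw [mean_sub, mean_sub, mean_const_mul, mean_const_mul] at hmean
  change mean (fun i => f i (y t i)) - objective f w - _ ≤ _ at hmean
  have hsq : mean (g t) ^ 2 ≤ L ^ 2 := by
    have := abs_le.1 (abs_mean_le_of_forall hn hg)
    exact sq_le_sq' this.1 this.2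
  rw [h.mean_y_succ ht]
  have h4 := mul_le_mul_of_nonneg_left hmean (by positivity : 0 ≤ 2 * β)
  have h5 := mul_le_mul_of_nonneg_left hsq (sq_nonneg β)
  linarith

lemma sum_mean_sub_le (h : IsProtocolRun G f U β x y z g) (hn : 0 < n) (hβ : 0 < β) {L : ℝ}
    (hL : ∀ i θ s, IsSubgradient (f i) θ s → |s| ≤ L) (w : ℝ) (T : ℕ) :
    ∑ t ∈ Icc 1 T, (mean (fun i => f i (y t i)) - objective f w)
      ≤ (mean (x 1) - w) ^ 2 / (2 * β) + T * (β * L ^ 2 / 2)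
        + L * ∑ t ∈ Icc 1 T, mean (fun i => |y t i - mean (y t)|) := by
  have key : 2 * β * ∑ t ∈ Icc 1 T, (mean (fun i => f i (y t i)) - objective f w)
      ≤ (mean (x 1) - w) ^ 2 - (mean (y (T + 1)) - w) ^ 2 + T * (β ^ 2 * L ^ 2)
        + 2 * β * (L * ∑ t ∈ Icc 1 T, mean (fun i => |y t i - mean (y t)|)) := by
    induction T with
    | zero => simp [show y 1 = x 1 from funext h.init_y]
    | succ T ih =>
      rw [sum_Icc_succ_top (by omega), sum_Icc_succ_top (by omega)]
      have := h.two_mul_mean_sub_le hn hβ.le hL w (Nat.le_add_left 1 T)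
      push_cast
      linarith
  have h2 : 0 < 2 * β := by positivity
  rw [← mul_le_mul_iff_right₀ h2]
  calc _ ≤ _ := key
    _ ≤ (mean (x 1) - w) ^ 2 + T * (β ^ 2 * L ^ 2)
        + 2 * β * (L * ∑ t ∈ Icc 1 T, mean (fun i => |y t i - mean (y t)|)) := by
        linarith [sq_nonneg (mean (y (T + 1)) - w)]
    _ = _ := by
        field_simp

end IsProtocolRun

/-! ### Running averages -/

section RunningAvg

variable {n : ℕ}

lemma mean_abs_runningAvg_sub_le (y : ℕ → Fin n → ℝ) {T : ℕ} :
    mean (fun i => |runningAvg y T i - mean (runningAvg y T)|)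
      ≤ 1 / (T : ℝ) * ∑ t ∈ Icc 1 T, mean (fun i => |y t i - mean (y t)|) := by
  have hm : mean (runningAvg y T) = 1 / (T : ℝ) * ∑ t ∈ Icc 1 T, mean (y t) := by
    rw [← mean_sum, ← mean_const_mul]
    rfl
  rw [← mean_sum, ← mean_const_mul]
  refine mean_mono fun i => ?_
  rw [hm, runningAvg, ← mul_sub, ← sum_sub_distrib, abs_mul,
    abs_of_nonneg (by positivity : (0 : ℝ) ≤ 1 / T)]
  exact mul_le_mul_of_nonneg_left (abs_sum_le_sum_abs _ _) (by positivity)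

lemma err_runningAvg_le {f : Fin n → ℝ → ℝ} (hf : ∀ i, ConvexOn ℝ Set.univ (f i)) (w : ℝ)
    (y : ℕ → Fin n → ℝ) {T : ℕ} (hT : 1 ≤ T) :
    err f w (runningAvg y T)
      ≤ 1 / (T : ℝ) * ∑ t ∈ Icc 1 T, (mean (fun i => f i (y t i)) - objective f w) := by
  have hT' : (0 : ℝ) < T := by exact_mod_cast hT
  have h : ∀ i, f i (runningAvg y T i) ≤ 1 / (T : ℝ) * ∑ t ∈ Icc 1 T, f i (y t i) := by
    intro i
    have := (hf i).map_sum_le (t := Icc 1 T) (w := fun _ => 1 / (T : ℝ)) (p := fun t => y t i)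
      (fun _ _ => by positivity) (by simp [hT'.ne']) (fun _ _ => Set.mem_univ _)
    simp only [smul_eq_mul, ← mul_sum] at this
    exact this
  have hm := mean_mono h
  rw [mean_const_mul, mean_sum] at hm
  have hc : 1 / (T : ℝ) * ∑ _t ∈ Icc 1 T, objective f w = objective f w := by
    simp [hT'.ne']
  rw [sum_sub_distrib, mul_sub, hc]
  exact sub_le_sub_right hm _

/-- The error can be negative because the nodes use different points. Moving all of them to their
mean costs `L` times the deviation, and there minimality of `w` applies. -/
lemma neg_le_err {f : Fin n → ℝ → ℝ} (hf : ∀ i, ConvexOn ℝ Set.univ (f i)) {L w : ℝ}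
    (hL : ∀ i θ s, IsSubgradient (f i) θ s → |s| ≤ L)
    (hw : ∀ θ, objective f w ≤ objective f θ) (θ : Fin n → ℝ) :
    -(L * mean (fun i => |θ i - mean θ|)) ≤ err f w θ := by
  have h1 := mean_mono fun i =>
    sub_le_mul_abs_sub_of_subgradient_bounded (hf i) (hL i) (mean θ) (θ i)
  simp only [abs_sub_comm (mean θ)] at h1
  rw [mean_sub, mean_const_mul] at h1
  have h2 := hw (mean θ)
  change -_ ≤ mean (fun i => f i (θ i)) - objective f w
  change objective f (mean θ) - _ ≤ _ at h1
  linarith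

end RunningAvg

end DistOpt

theorem mainTheorem2 :
    ∀ C : ℝ, ∃ K : ℝ, 0 < K ∧
      ∀ (n : ℕ) (G : SimpleGraph (Fin n)) [DecidableRel G.Adj], G.Connected →
      ∀ U : ℝ, (n : ℝ) ≤ U → U ≤ C * (n : ℝ) →
      ∀ f : Fin n → ℝ → ℝ, (∀ i, ConvexOn ℝ Set.univ (f i)) →
      ∀ L : ℝ, 0 < L →
        (∀ i θ s, DistOpt.IsSubgradient (f i) θ s → |s| ≤ L) →
      ∀ w : ℝ, (∀ θ : ℝ, DistOpt.objective f w ≤ DistOpt.objective f θ) →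
      ∀ T : ℕ, 1 ≤ T →
      ∀ x y z g : ℕ → Fin n → ℝ,
        DistOpt.IsProtocolRun G f U (1 / (L * Real.sqrt (U * (T : ℝ)))) x y z g →
        DistOpt.disp (DistOpt.runningAvg y T) ≤
            K * (Real.sqrt ((n : ℝ) / (T : ℝ)) *
              (DistOpt.l2Dev (y 1) (DistOpt.mean (x 1)) / Real.sqrt (T : ℝ) + 1)) ∧
        |DistOpt.err f w (DistOpt.runningAvg y T)| ≤
            K * (L * Real.sqrt ((n : ℝ) / (T : ℝ)) *
              (DistOpt.l2Dev (y 1) (DistOpt.mean (x 1)) / Real.sqrt (T : ℝ) + 1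
                + (DistOpt.mean (x 1) - w) ^ 2)) := by
  intro C
  -- The deviation and initial-distance terms are absorbed by `40 * C`, the step-size term by `1`.
  -- The absolute value only keeps `K` positive when `C < 0`, a case excluded below since `n ≤ U ≤ C
  -- * n` forces `C ≥ 1`.
  refine ⟨40 * |C| + 1, by positivity, ?_⟩
  intro n G _ hG U hU hUC f hf L hL0 hL w hw T hT x y z g h
  have hn : 0 < n := Fin.pos_iff_nonempty.2 hG.nonempty
  have hn1 : (1 : ℝ) ≤ n := by exact_mod_cast hn
  have hT' : (0 : ℝ) < T := by exact_mod_cast hT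
  have hU0 : 0 < U := by linarith
  have hC1 : 1 ≤ C := by
    by_contra hC
    nlinarith
  rw [abs_of_pos (by linarith)]
  have hD := h.avg_mean_abs_deviation_le hG hU hUC hL0 hL hT
  have havg := DistOpt.mean_abs_runningAvg_sub_le y (T := T)
  have hdisp := DistOpt.disp_le_mean_abs_sub hn (DistOpt.runningAvg y T)
    (DistOpt.mean (DistOpt.runningAvg y T))
  have hlow := DistOpt.neg_le_err hf hL hw (DistOpt.runningAvg y T)
  have hup := DistOpt.err_runningAvg_le hf w y hT
  have hsub := h.sum_mean_sub_le hn (by positivity) hL w T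
  set N := DistOpt.l2Dev (y 1) (DistOpt.mean (x 1)) / √T
  have hN : 0 ≤ N := div_nonneg (norm_nonneg _) (Real.sqrt_nonneg _)
  set R := √((n : ℝ) / T) with hR
  have hR0 : 0 ≤ R := Real.sqrt_nonneg _
  set S := ∑ t ∈ Icc 1 T, DistOpt.mean (fun i => |y t i - DistOpt.mean (y t)|)
  set q := (DistOpt.mean (x 1) - w) ^ 2
  have hq : 0 ≤ q := sq_nonneg _
  have hRN : 0 ≤ R * (N + 1) := by positivity
  refine ⟨by linarith, ?_⟩
  have hLD : L * (1 / (T : ℝ) * S) ≤ 40 * C * (L * R * (N + 1)) := by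
    have := mul_le_mul_of_nonneg_left hD hL0.le
    linarith
  have hsT : 0 < √(T : ℝ) := Real.sqrt_pos.2 hT'
  have hsU : 0 < √U := Real.sqrt_pos.2 hU0
  have eT : √(T : ℝ) * √T = T := Real.mul_self_sqrt hT'.le
  have hinit : 1 / (T : ℝ) * (q / (2 * (1 / (L * √(U * T))))) ≤ C * (L * R * q) := by
    have e : 1 / (T : ℝ) * (q / (2 * (1 / (L * √(U * T))))) = L * q / 2 * √(U / T) := by
      rw [Real.sqrt_mul hU0.le, Real.sqrt_div hU0.le]
      have alg : ∀ a b : ℝ, 0 < a → 0 < b →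
          1 / (b * b) * (q / (2 * (1 / (L * (a * b))))) = L * q / 2 * (a / b) :=
        fun a b ha hb => by field_simp
      have := alg _ _ hsU hsT
      rwa [eT] at this
    -- Here `U ≤ C n ≤ C² n`, using `C ≥ 1`.
    have h1 : √(U / T) ≤ C * R := by
      rw [hR, Real.sqrt_le_left (by positivity), mul_pow, Real.sq_sqrt (by positivity),
        mul_div_assoc']
      refine div_le_div_of_nonneg_right (hUC.trans ?_) hT'.le
      nlinarith
    rw [e]
    calc L * q / 2 * √(U / T) ≤ L * q / 2 * (C * R) := by gcongr
      _ ≤ _ := by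
        have : 0 ≤ C * (L * R * q) := by positivity
        linarith
  have hstep : 1 / (T : ℝ) * (T * (1 / (L * √(U * T)) * L ^ 2 / 2)) ≤ L * R := by
    have e : 1 / (T : ℝ) * (T * (1 / (L * √(U * T)) * L ^ 2 / 2)) = L / 2 * (1 / √(U * T)) := by
      field_simp
    have h1 : 1 / √(U * T) ≤ R := by
      rw [Real.sqrt_mul hU0.le, hR, Real.sqrt_div (by positivity)]
      have h2 : 1 ≤ √U := Real.one_le_sqrt.2 (hn1.trans hU)
      have h3 : 1 ≤ √(n : ℝ) := Real.one_le_sqrt.2 hn1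
      rw [div_le_div_iff₀ (by positivity) hsT]
      nlinarith [mul_le_mul h3 h2 zero_le_one (by positivity)]
    rw [e]
    have := mul_le_mul_of_nonneg_left h1 hL0.le
    have : 0 ≤ L * (1 / √(U * T)) := by positivity
    linarith
  have hLRq : 0 ≤ L * R * q := by positivity
  have hLRN : 0 ≤ L * R * N := by positivity
  have hLR : 0 ≤ L * R := by positivity
  have hCq : 0 ≤ C * (L * R * q) := by positivity
  rw [abs_le]
  constructor
  · have := mul_le_mul_of_nonneg_left havg hL0.le
    linarith
  · have := mul_le_mul_of_nonneg_left hsub (by positivity : 0 ≤ 1 / (T : ℝ))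
    linarith
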